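/- **Setting.** Let $T>0$ and let $(\Omega,\mathcal F,\mathbb F=(\mathcal F_t)_{0\le t\le T})$ be a right-continuous filtered measurable space with $\mathcal F_T=\mathcal F$, carrying $\mathbb F$-adapted processes $W$ (real), $N^-,N^+$ (counting processes: $\mathbb N$-valued, càdlàg, nondecreasing, null at $0$, with unit jumps) and $Y$ (càdlàg, with values in $\{1,\dots,k\}$). Let $\mathcal N\subseteq\mathcal F_0$ be a $\sigma$-algebra, the completed trivial $\sigma$-algebra (see (a) below). Let $\mathbb F^{N,W}$ be the observable filtration, i.e. the right-continuous version of $\big(\sigma(W_u,N^-_u,N^+_u:u\le t)\vee\mathcal N\big)_{0\le t\le T}$. Fix $-\infty\le\delta_*<\delta^*\le+\infty$, put $D=\mathbb R\cap[\delta_*,\delta^*]$, and let $\mathcal A$ be the set of bounded $\mathbb F^{N,W}$-predictable processes $\delta:[0,T]\times\Omega\to D$. Let $n_0\in\mathbb Z$, $N^*\in\mathbb N\cup\{+\infty\}$ with $|n_0|\le N^*$, $\gamma\ge 0$, and set $$N_t=n_0+N^-_t-N^+_t,\qquad \mathbf 1^{\pm}_t=\mathbf 1_{\{\mp N_{t-}<N^*\}}.$$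 Let $\Lambda^\pm_i:D\to(0,\infty)$, $1\le i\le k$, be continuous and nonincreasing, with $\lim_{\delta\to+\infty}\delta^{\mathbf 1_{\{\gamma=0\}}}\Lambda_i^\pm(\delta)=0$ if $\delta^*=+\infty$. Let $Q=(q^{ij}_t)$ be a continuous matrix function on $[0,T]$ with $q^{ij}_t\ge0$ for $j\ne i$ and $\sum_jq^{ij}_t=0$, and let $\mu_0$ be a probability vector on $\{1,\dots,k\}$. Let $(\mathbb P^\alpha)_{\alpha\in\mathcal A^2}$, $\alpha=(\delta^-,\delta^+)$, be a family of equivalent probability measures such that, for every $\alpha\in\mathcal A^2$: (a) $\mathcal N$ is the $\sigma$-algebra generated by the null sets of $\mathbb P^\alpha$; (b) for $(\mathbb F,\mathbb P^\alpha)$, $W$ is a Wiener process and $Y$ is a Markov chain with initial distribution $\mu_0$ and generator matrix $Q$; (c) $\mathbb P^\alpha$-a.s. no two of $N^-,N^+,Y$ have a common jump; (d) $N^\pm$ has $(\mathbb P^\alpha,\mathbb F)$-predictable intensity $\lambda^{\pm}_t=\mathbf 1^\pm_t\,\Lambda^\pm_{Y_{t-}}(\delta^\pm_t)$. Here a process $\lambda$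 is a $(\mathbb P,\mathbb G)$-predictable intensity of a counting process $M$ if it is $\mathbb G$-predictable, a.s. nonnegative with $\int_0^T\lambda_t\,dt<\infty$ a.s., and $\mathbb E\int_0^TC_t\,dM_t=\mathbb E\int_0^TC_t\lambda_t\,dt$ for all $\mathbb G$-predictable $C\ge0$. A predictable kernel $\eta_t(dz)$ from $[0,T]\times\Omega$ to $\mathbb R$ is a $(\mathbb P,\mathbb G)$-predictable intensity kernel of the jump measure $\mu^X(dt,dz)=\sum_{s:\Delta X_s\neq0}\delta_{(s,\Delta X_s)}$ of a process $X$ if $\int_0^T\eta_t(\mathbb R)\,dt<\infty$ a.s. and $\mathbb E\int\!\!\int H(t,z)\,\mu^X(dt,dz)=\mathbb E\int_0^T\!\!\int H(t,z)\,\eta_t(dz)\,dt$ for all $H\ge0$ measurable for the product of the $\mathbb G$-predictable and the Borel $\sigma$-algebra (that is, $\eta_t(dz)\,dt$ is the compensator of $\mu^X$). **Proposition (observable intensities).** Let $\alpha=(\delta^-,\delta^+)\in\mathcal A^2$, and for $1\le i\le k$ let $\Pi^{i}$ be the optional projection of $\mathbf 1_{\{Y_\cdot=i\}}$ on $\mathbb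 F^{N,W}$ under $\mathbb P^\alpha$, i.e. the (up to evanescence unique) càdlàg process with $\Pi^i_t=\mathbb P^\alpha(Y_t=i\mid\mathcal F^{N,W}_t)$ a.s. for each $t\in[0,T]$. Then the $(\mathbb P^\alpha,\mathbb F^{N,W})$-predictable intensities of $N^\pm$ are $$\widehat{\lambda^\pm_t}=\mathbf 1^\pm_t\sum_{i=1}^k\Pi^i_{t-}\,\Lambda^\pm_i(\delta^\pm_t),$$ and the $(\mathbb P^\alpha,\mathbb F^{N,W})$-predictable intensity kernel of the jump measure $\mu^N$ of $N$ is $$\widehat\eta_t(dz)=\widehat{\lambda^-_t}\,m_1(dz)+\widehat{\lambda^+_t}\,m_{-1}(dz),$$ where $m_{z}$ is the Dirac measure at $z$. -/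

import Mathlib

open MeasureTheory ProbabilityTheory Filter Topology
open scoped NNReal ENNReal

namespace MarketMaking

/-! ### Time, paths, point processes and intensities

The time interval `[0, T]` is the subtype `Set.Iic T` of `ℝ≥0`.
The left limit of a path at time `t` is `Function.leftLim x t`, with the usual convention
that the left limit at time `0` is the value at time `0`. -/

section General

variable {Ω : Type*} [mΩ : MeasurableSpace Ω] {T : ℝ≥0}

/-- Lebesgue measure on `[0, T]`. -/
noncomputable def lebesgue (T : ℝ≥0) : Measure (Set.Iic T) :=
  (volume : Measure ℝ).comap fun t ↦ ((t : ℝ≥0) : ℝ)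

/-- A path on `[0, T]` that is right-continuous and has left limits. -/
def IsCadlag {E : Type*} [TopologicalSpace E] (x : Set.Iic T → E) : Prop :=
  ∀ t, ContinuousWithinAt x (Set.Ici t) t ∧ ∃ l, Tendsto x (𝓝[<] t) (𝓝 l)

/-- A path of a (non-explosive) counting process: it starts at `0`, is nondecreasing, càdlàg and
has jumps of size one. -/
structure IsCountingPath (x : Set.Iic T → ℕ) : Prop where
  zero : x ⊥ = 0
  mono : Monotone x
  cadlag : IsCadlag x
  jump_le_one : ∀ t, x t ≤ Function.leftLim x t + 1

/-- The path `x` jumps at time `t`. -/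
def JumpsAt {E : Type*} [TopologicalSpace E] (x : Set.Iic T → E) (t : Set.Iic T) : Prop :=
  x t ≠ Function.leftLim x t

/-- Two paths have no common jump time. -/
def NoCommonJumps {E F : Type*} [TopologicalSpace E] [TopologicalSpace F]
    (x : Set.Iic T → E) (y : Set.Iic T → F) : Prop :=
  ∀ t, ¬ (JumpsAt x t ∧ JumpsAt y t)

/-- The measure `dx` on `[0, T]` of a counting path `x`: one unit mass at each jump time. -/
noncomputable def countingMeasure (x : Set.Iic T → ℕ) : Measure (Set.Iic T) :=
  Measure.sum fun t : {t // JumpsAt x t} ↦ Measure.dirac (t : Set.Iic T)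

/-- The jump measure of a real path `x` on `[0, T] × ℝ`: one unit mass at each pair
`(t, x t - x (t-))` with `x t ≠ x (t-)`. -/
noncomputable def jumpMeasure (x : Set.Iic T → ℝ) : Measure (Set.Iic T × ℝ) :=
  Measure.sum fun t : {t // JumpsAt x t} ↦
    Measure.dirac ((t : Set.Iic T), x t - Function.leftLim x t)

/-- `lam` is a `(P, 𝓖)`-predictable intensity of the counting process `N`: it is
`𝓖`-predictable, almost surely nonnegative and integrable over `[0, T]`, and
`E ∫ C dN = E ∫ C lam dt` for every `𝓖`-predictable process `C ≥ 0`. -/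
structure HasPredictableIntensity (P : Measure Ω) (𝓖 : Filtration (Set.Iic T) mΩ)
    (N : Set.Iic T → Ω → ℕ) (lam : Set.Iic T × Ω → ℝ) : Prop where
  predictable : Measurable[𝓖.predictable] lam
  nonneg : ∀ᵐ ω ∂P, ∀ t, 0 ≤ lam (t, ω)
  integrable : ∀ᵐ ω ∂P, ∫⁻ t, ENNReal.ofReal (lam (t, ω)) ∂(lebesgue T) < ∞
  projection : ∀ C : Set.Iic T × Ω → ℝ≥0∞, Measurable[𝓖.predictable] C →
    ∫⁻ ω, ∫⁻ t, C (t, ω) ∂(countingMeasure fun t ↦ N t ω) ∂P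
      = ∫⁻ ω, ∫⁻ t, C (t, ω) * ENNReal.ofReal (lam (t, ω)) ∂(lebesgue T) ∂P

/-- `η` is a `(P, 𝓖)`-predictable intensity kernel of the jump measure `μ` of the process `X`,
that is, `η_t(dz) dt` is the `(P, 𝓖)`-compensator of `μ(dt, dz)`: the kernel is
`𝓖`-predictable, almost surely of finite total mass over `[0, T]`, and
`E ∫∫ H(t, z) μ(dt, dz) = E ∫∫ H(t, z) η_t(dz) dt` for every `H ≥ 0` that is measurable for the
product of the `𝓖`-predictable and the Borel σ-algebra. -/
structure HasPredictableIntensityKernel (P : Measure Ω) (𝓖 : Filtration (Set.Iic T) mΩ)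
    (X : Set.Iic T → Ω → ℝ) (η : Set.Iic T × Ω → Measure ℝ) : Prop where
  predictable : Measurable[𝓖.predictable] η
  integrable : ∀ᵐ ω ∂P, ∫⁻ t, η (t, ω) Set.univ ∂(lebesgue T) < ∞
  projection : ∀ H : (Set.Iic T × Ω) × ℝ → ℝ≥0∞,
    Measurable[𝓖.predictable.prod (borel ℝ)] H →
    ∫⁻ ω, ∫⁻ q, H ((q.1, ω), q.2) ∂(jumpMeasure fun t ↦ X t ω) ∂P
      = ∫⁻ ω, ∫⁻ t, ∫⁻ z, H ((t, ω), z) ∂(η (t, ω)) ∂(lebesgue T) ∂P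

/-- `Z` is (a version of) the optional projection of the bounded càdlàg process `X` on `𝓖`:
the càdlàg process with `Z t = E[X t | 𝓖 t]` almost surely, for each `t`. -/
structure IsOptionalProjection (P : Measure Ω) (𝓖 : Filtration (Set.Iic T) mΩ)
    (X Z : Set.Iic T → Ω → ℝ) : Prop where
  cadlag : ∀ ω, IsCadlag fun t ↦ Z t ω
  condExp : ∀ t, Z t =ᵐ[P] P[X t | 𝓖 t]

/-- `W` is a standard Wiener process on `[0, T]` for `(𝓖, P)`. -/
structure IsWiener (P : Measure Ω) (𝓖 : Filtration (Set.Iic T) mΩ)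
    (W : Set.Iic T → Ω → ℝ) : Prop where
  adapted : ∀ t, Measurable[𝓖 t] (W t)
  zero : ∀ᵐ ω ∂P, W ⊥ ω = 0
  continuous : ∀ᵐ ω ∂P, Continuous fun t ↦ W t ω
  law_increment : ∀ s t : Set.Iic T, s ≤ t →
    HasLaw (fun ω ↦ W t ω - W s ω) (gaussianReal 0 ((t : ℝ≥0) - (s : ℝ≥0))) P
  indep_increment : ∀ s t : Set.Iic T, s ≤ t →
    Indep (MeasurableSpace.comap (fun ω ↦ W t ω - W s ω) inferInstance) (𝓖 s) P

/-- A continuous, stable and conservative time-dependent generator matrix. -/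
structure IsGenerator {k : ℕ} (Q : Set.Iic T → Matrix (Fin k) (Fin k) ℝ) : Prop where
  nonneg : ∀ t i j, j ≠ i → 0 ≤ Q t i j
  sum_eq_zero : ∀ t i, ∑ j, Q t i j = 0
  continuous : Continuous Q

/-- `p s t` (for `s ≤ t`) are the transition matrices generated by `Q`: the solution of the
forward equation `∂ₜ p s t = p s t * Q t`, `p s s = 1`, in integrated form. -/
structure IsTransitionMatrix {k : ℕ} (Q : Set.Iic T → Matrix (Fin k) (Fin k) ℝ)
    (p : Set.Iic T → Set.Iic T → Matrix (Fin k) (Fin k) ℝ) : Prop where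
  continuousOn : ∀ s, ContinuousOn (p s) (Set.Ici s)
  forward : ∀ s t, s ≤ t → ∀ i j,
    p s t i j = (1 : Matrix (Fin k) (Fin k) ℝ) i j + ∫ u in Set.Ioc s t, (p s u * Q u) i j ∂(lebesgue T)

/-- `Y` is a càdlàg Markov chain for `(𝓖, P)` with states `Fin k`, initial distribution `μ₀` and
generator matrix `Q`. -/
structure IsMarkovChain {k : ℕ} (P : Measure Ω) (𝓖 : Filtration (Set.Iic T) mΩ)
    (μ₀ : Fin k → ℝ) (Q : Set.Iic T → Matrix (Fin k) (Fin k) ℝ)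
    (Y : Set.Iic T → Ω → Fin k) : Prop where
  adapted : ∀ t, Measurable[𝓖 t] (Y t)
  cadlag : ∀ ω, IsCadlag fun t ↦ Y t ω
  initial : ∀ i, P.real (Y ⊥ ⁻¹' {i}) = μ₀ i
  markov : ∃ p, IsTransitionMatrix Q p ∧ ∀ s t, s ≤ t → ∀ j,
    P⟦Y t ⁻¹' {j} | 𝓖 s⟧ =ᵐ[P] fun ω ↦ p s t (Y s ω) j

end General

/-! ### The market making model -/

/-- The two sides of the market: `minus` (bid, the market maker buys) and `plus` (ask, she
sells). -/
inductive Side : Type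
  | minus
  | plus

/-- The change of the inventory at an order on the given side. -/
def Side.sign : Side → ℤ
  | .minus => 1
  | .plus => -1

/-- `z < c` for an integer `z` and `c ∈ ℕ ∪ {∞}`. -/
def BelowCap (c : ℕ∞) (z : ℤ) : Prop := ∀ m : ℕ, c = m → z < m

/-- The closure in `ℝ` of the interval `(a, b)`, where `-∞ ≤ a < b ≤ ∞`. -/
def spreadRange (a b : EReal) : Set ℝ := {x | a ≤ (x : EReal) ∧ (x : EReal) ≤ b}

/-- The parameters of the model: the chain (`μ₀`, `Q`), the initial inventory `n₀`, the inventory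
limit `Nmax`, the risk aversion `γ`, the spread constraints `lo < hi` and, for each side and each
regime, the order intensity function `Λ`. -/
structure Parameters (T : ℝ≥0) (k : ℕ) where
  μ₀ : Fin k → ℝ
  Q : Set.Iic T → Matrix (Fin k) (Fin k) ℝ
  isGenerator : IsGenerator Q
  n₀ : ℤ
  Nmax : ℕ∞
  n₀_le : (n₀.natAbs : ℕ∞) ≤ Nmax
  γ : ℝ
  γ_nonneg : 0 ≤ γ
  lo : EReal
  hi : EReal
  lo_lt_hi : lo < hi
  Λ : Side → Fin k → spreadRange lo hi → ℝ
  Λ_pos : ∀ s i x, 0 < Λ s i x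
  Λ_continuous : ∀ s i, Continuous (Λ s i)
  Λ_antitone : ∀ s i, Antitone (Λ s i)
  Λ_tendsto : hi = ⊤ → ∀ s i,
    Tendsto (fun x : spreadRange lo hi ↦ (if γ = 0 then (x : ℝ) else 1) * Λ s i x)
      (comap (fun x : spreadRange lo hi ↦ (x : ℝ)) atTop) (𝓝 0)

/-- The filtered measurable space with the observed processes `W` and `N⁻`, `N⁺`. The σ-algebra
`null` is the completed trivial σ-algebra: `Model.null_eq` below requires it to be the one
generated by the null sets of the physical measures. -/
structure Observation (T : ℝ≥0) (Ω : Type*) [mΩ : MeasurableSpace Ω] where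
  𝔽 : Filtration (Set.Iic T) mΩ
  rightContinuous : 𝔽.IsRightContinuous
  top_eq : 𝔽 ⊤ = mΩ
  null : MeasurableSpace Ω
  null_le : null ≤ 𝔽 ⊥
  W : Set.Iic T → Ω → ℝ
  N : Side → Set.Iic T → Ω → ℕ
  W_adapted : ∀ t, Measurable[𝔽 t] (W t)
  N_adapted : ∀ s t, Measurable[𝔽 t] (N s t)

namespace Observation

variable {Ω : Type*} [mΩ : MeasurableSpace Ω] {T : ℝ≥0}

/-- The completed natural filtration of `W`, `N⁻`, `N⁺`. -/
def natural (S : Observation T Ω) : Filtration (Set.Iic T) mΩ where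
  seq t := (⨆ u : Set.Iic T, ⨆ _ : u ≤ t,
    (MeasurableSpace.comap (S.W u) inferInstance ⊔
      ⨆ s : Side, MeasurableSpace.comap (S.N s u) inferInstance)) ⊔ S.null
  mono' _ _ hst := sup_le_sup_right (biSup_mono fun _ hu ↦ hu.trans hst) _
  le' t := by
    refine sup_le (iSup₂_le fun u _ ↦ sup_le ?_ (iSup_le fun s ↦ ?_))
      (S.null_le.trans (S.𝔽.le _))
    · exact ((S.W_adapted u).comap_le).trans (S.𝔽.le u)
    · exact ((S.N_adapted s u).comap_le).trans (S.𝔽.le u)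

/-- The observable filtration: the natural filtration of `W`, `N⁻`, `N⁺`, augmented to satisfy
the usual conditions. -/
noncomputable def obs (S : Observation T Ω) : Filtration (Set.Iic T) mΩ :=
  S.natural.rightCont

/-- The inventory process `N = n₀ + N⁻ - N⁺`. -/
def inventory (S : Observation T Ω) (n₀ : ℤ) (t : Set.Iic T) (ω : Ω) : ℤ :=
  n₀ + S.N .minus t ω - S.N .plus t ω

/-- The admissible spreads with values in `D`: bounded and predictable for the observable
filtration. -/
def Admissible (S : Observation T Ω) (D : Set ℝ) : Type _ :=
  {δ : Set.Iic T × Ω → D //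
    Measurable[S.obs.predictable] δ ∧ ∃ c : ℝ, ∀ q, |(δ q : ℝ)| ≤ c}

/-- Strategies: a pair of admissible spreads `(δ⁻, δ⁺)`. -/
abbrev Strategy (S : Observation T Ω) (D : Set ℝ) : Type _ := Side → S.Admissible D

/-- The indicator `𝟙^±_t` of `∓N_{t-} < Nmax`. -/
noncomputable def active (S : Observation T Ω) (n₀ : ℤ) (Nmax : ℕ∞) (s : Side)
    (q : Set.Iic T × Ω) : ℝ :=
  open Classical in
  if BelowCap Nmax (s.sign * Function.leftLim (fun t ↦ S.inventory n₀ t q.2) q.1) then 1 else 0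

end Observation

variable {Ω : Type*} [mΩ : MeasurableSpace Ω] {T : ℝ≥0} {k : ℕ}

/-- The full-information intensity `𝟙^±_t Λ^±_{Y_{t-}}(δ^±_t)`. -/
noncomputable def fullIntensity (par : Parameters T k) (S : Observation T Ω)
    (Y : Set.Iic T → Ω → Fin k) (α : S.Strategy (spreadRange par.lo par.hi)) (s : Side)
    (q : Set.Iic T × Ω) : ℝ :=
  S.active par.n₀ par.Nmax s q *
    par.Λ s (Function.leftLim (fun t ↦ Y t q.2) q.1) ((α s).1 q)

/-- The observable intensity `𝟙^±_t ∑ᵢ π^i_{t-} Λ^±_i(δ^±_t)` for weights `π`. -/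
noncomputable def observableIntensity (par : Parameters T k) (S : Observation T Ω)
    (π : Fin k → Set.Iic T → Ω → ℝ) (α : S.Strategy (spreadRange par.lo par.hi)) (s : Side)
    (q : Set.Iic T × Ω) : ℝ :=
  S.active par.n₀ par.Nmax s q *
    ∑ i, Function.leftLim (fun t ↦ π i t q.2) q.1 * par.Λ s i ((α s).1 q)

/-- The observable kernel: the observable intensity of `N⁻` times the unit mass at `1`, plus the
observable intensity of `N⁺` times the unit mass at `-1`. -/
noncomputable def observableKernel (par : Parameters T k) (S : Observation T Ω)
    (π : Fin k → Set.Iic T → Ω → ℝ) (α : S.Strategy (spreadRange par.lo par.hi))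
    (q : Set.Iic T × Ω) : Measure ℝ :=
  ENNReal.ofReal (observableIntensity par S π α .minus q) • Measure.dirac (1 : ℝ) +
    ENNReal.ofReal (observableIntensity par S π α .plus q) • Measure.dirac (-1 : ℝ)

/-- The model: a hidden regime process `Y` and an equivalent family of physical probability
measures `P α`, one for each strategy `α`, under each of which `W` is a Wiener process, `Y` is a
Markov chain with generator `Q`, and `N^±` are counting processes with the prescribed
full-information intensities, with a.s. no common jumps among `N⁻`, `N⁺`, `Y`. -/
structure Model (par : Parameters T k) (S : Observation T Ω) where
  Y : Set.Iic T → Ω → Fin k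
  P : S.Strategy (spreadRange par.lo par.hi) → Measure Ω
  isProbabilityMeasure : ∀ α, IsProbabilityMeasure (P α)
  equivalent : ∀ α β, P α ≪ P β
  null_eq : ∀ α, S.null = MeasurableSpace.generateFrom {A | P α A = 0}
  wiener : ∀ α, IsWiener (P α) S.𝔽 S.W
  markovChain : ∀ α, IsMarkovChain (P α) S.𝔽 par.μ₀ par.Q Y
  counting : ∀ s ω, IsCountingPath fun t ↦ S.N s t ω
  noCommonJumps : ∀ α, ∀ᵐ ω ∂(P α),
    NoCommonJumps (fun t ↦ S.N .minus t ω) (fun t ↦ S.N .plus t ω)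
  noCommonJumps_Y : ∀ α s, ∀ᵐ ω ∂(P α), NoCommonJumps (fun t ↦ S.N s t ω) (fun t ↦ Y t ω)
  intensity : ∀ α s, HasPredictableIntensity (P α) S.𝔽 (S.N s) (fullIntensity par S Y α s)

/-- `π` is the filter under `P α`: `π i` is the optional projection of `𝟙{Y_t = i}` on the
observable filtration. -/
def Model.IsFilter {par : Parameters T k} {S : Observation T Ω} (M : Model par S)
    (α : S.Strategy (spreadRange par.lo par.hi)) (π : Fin k → Set.Iic T → Ω → ℝ) : Prop :=
  ∀ i, IsOptionalProjection (M.P α) S.obs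
    (fun t ↦ (M.Y t ⁻¹' {i}).indicator fun _ ↦ (1 : ℝ)) (π i)

end MarketMaking

namespace MarketMaking

/-! ### Càdlàg paths -/

section Paths

variable {T : ℝ≥0} {E F : Type*} [TopologicalSpace E] [TopologicalSpace F]

/-! The claim is a tower property for intensities. Since `𝔽` is right-continuous, the observable
filtration is contained in it, so an observable predictable test process `C` is `𝔽`-predictable, and
the model gives `E ∫ C dN = E ∫ C λ dt` with the full-information intensity `λ`. It remains to
replace `λ` by the observable intensity under the integral.

Split by regime: `C λ = ∑ᵢ Kᵢ 𝟙{Y_{t-} = i}`, where `Kᵢ = C 𝟙^± Λᵢ(δ)` is observable and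
predictable. A càdlàg path has countably many jumps, so `dt`-almost everywhere `Y_{t-}` may be
replaced by `Y_t`. By Tonelli one may fix `t`; then `Kᵢ(t, ·)` is measurable for the observable
σ-algebra at `t`, and `𝟙{Y_t = i}` may be replaced by its conditional expectation `Πⁱ_t`. Undoing
the first step restores the left limit (`IsOptionalProjection.lintegral_mul_leftLim_eq`,
`lintegral_fullIntensity_eq`).

The result is predictable because left limits of adapted càdlàg processes are
(`measurable_leftLim_predictable`), and `Πⁱ` is adapted because the filtration contains the null
sets. It is nonnegative and integrable because a.s. `Πⁱ` stays in `[0, 1]` and `Λᵢ(δ)` is bounded.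

For the kernel, the absence of common jumps splits the jump measure of the inventory into `dN⁻` at
height `1` and `dN⁺` at height `-1` (`lintegral_jumpMeasure_sub`). This reduces it to the
intensities, tested against `H(·, 1)` and `H(·, -1)`. -/

lemma IsCadlag.comp {x : Set.Iic T → E} (hx : IsCadlag x) {g : E → F} (hg : Continuous g) :
    IsCadlag fun t ↦ g (x t) := fun t ↦ by
  obtain ⟨h, l, hl⟩ := hx t
  exact ⟨hg.continuousAt.comp_continuousWithinAt h, g l, (hg.tendsto l).comp hl⟩

lemma IsCadlag.prodMk {x : Set.Iic T → E} {y : Set.Iic T → F} (hx : IsCadlag x)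
    (hy : IsCadlag y) : IsCadlag fun t ↦ (x t, y t) := fun t ↦ by
  obtain ⟨h, l, hl⟩ := hx t
  obtain ⟨h', l', hl'⟩ := hy t
  exact ⟨h.prodMk h', (l, l'), hl.prodMk_nhds hl'⟩

lemma IsCadlag.tendsto_leftLim {x : Set.Iic T → E} (hx : IsCadlag x) (t : Set.Iic T) :
    Tendsto x (𝓝[<] t) (𝓝 (Function.leftLim x t)) :=
  tendsto_leftLim_of_tendsto (hx t).2

lemma nhdsLT_bot_eq_bot : 𝓝[<] (⊥ : Set.Iic T) = ⊥ := by simp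

lemma nhdsLT_neBot {t : Set.Iic T} (ht : ⊥ < t) : (𝓝[<] t).NeBot :=
  nhdsLT_neBot_of_exists_lt ⟨⊥, ht⟩

lemma leftLim_bot (x : Set.Iic T → E) : Function.leftLim x ⊥ = x ⊥ :=
  leftLim_eq_of_eq_bot x nhdsLT_bot_eq_bot

lemma IsCadlag.leftLim_comp [T2Space F] {x : Set.Iic T → E} (hx : IsCadlag x) {g : E → F}
    (hg : Continuous g) (t : Set.Iic T) :
    Function.leftLim (fun t ↦ g (x t)) t = g (Function.leftLim x t) := by
  rcases eq_bot_or_bot_lt t with rfl | ht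
  · simp only [leftLim_bot]
  · have := nhdsLT_neBot ht
    exact leftLim_eq_of_tendsto ((hg.tendsto _).comp (hx.tendsto_leftLim t))

lemma IsCadlag.leftLim_prodMk [T2Space E] [T2Space F] {x : Set.Iic T → E} {y : Set.Iic T → F}
    (hx : IsCadlag x) (hy : IsCadlag y) (t : Set.Iic T) :
    Function.leftLim (fun t ↦ (x t, y t)) t = (Function.leftLim x t, Function.leftLim y t) := by
  rcases eq_bot_or_bot_lt t with rfl | ht
  · simp only [leftLim_bot]
  · have := nhdsLT_neBot ht
    exact leftLim_eq_of_tendsto ((hx.tendsto_leftLim t).prodMk_nhds (hy.tendsto_leftLim t))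

/-- If `x (t-) < q < x t` with `q` rational, then `x < q` just before `t`, so `t` is isolated from
the left in `{q < x}`. Each such set has only countably many left-isolated points. -/
lemma countable_setOf_leftLim_lt {x : Set.Iic T → ℝ} (hx : IsCadlag x) :
    {t | Function.leftLim x t < x t}.Countable := by
  have h : {t | Function.leftLim x t < x t} ⊆
      ⋃ q : ℚ, {t | t ∈ {t | (q : ℝ) < x t} ∧ 𝓝[{t | (q : ℝ) < x t} ∩ Set.Iio t] t = ⊥} := by
    intro t ht
    obtain ⟨q, hq, hq'⟩ := exists_rat_btwn (show Function.leftLim x t < x t from ht)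
    refine Set.mem_iUnion.2 ⟨q, hq', ?_⟩
    have := (hx.tendsto_leftLim t).eventually (gt_mem_nhds hq)
    rw [Set.inter_comm, nhdsWithin_inter', inf_principal_eq_bot]
    filter_upwards [this] with s hs hs'
    exact lt_asymm hs hs'
  exact (Set.countable_iUnion fun q ↦ countable_setOfPred_isolated_left_within).mono h

/-- A càdlàg path has countably many jumps. -/
lemma IsCadlag.countable_jumps {x : Set.Iic T → ℝ} (hx : IsCadlag x) :
    {t | Function.leftLim x t ≠ x t}.Countable := by
  have hneg := hx.comp continuous_neg
  refine ((countable_setOf_leftLim_lt hx).union (countable_setOf_leftLim_lt hneg)).mono ?_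
  intro t ht
  rcases lt_or_gt_of_ne ht with h | h
  · exact Or.inl h
  · refine Or.inr ?_
    simp only [Set.mem_ofPred_eq]
    rw [hx.leftLim_comp continuous_neg]
    exact neg_lt_neg h

end Paths

/-! ### Measurability of càdlàg processes and of their left limits -/

section Measurability

variable {Ω : Type*} [mΩ : MeasurableSpace Ω] {T : ℝ≥0}

lemma predictable_le_prod (𝓖 : Filtration (Set.Iic T) mΩ) :
    𝓖.predictable ≤ (inferInstance : MeasurableSpace (Set.Iic T × Ω)) :=
  measurableSpace_le_predictable_of_measurableSet
    (fun _ hA ↦ (measurableSet_singleton _).prod (𝓖.le _ _ hA))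
    (fun _ _ hA ↦ measurableSet_Ioi.prod (𝓖.le _ _ hA))

lemma predictable_mono {𝓖 𝓗 : Filtration (Set.Iic T) mΩ} (h : 𝓖 ≤ 𝓗) :
    𝓖.predictable ≤ 𝓗.predictable :=
  measurableSpace_le_predictable_of_measurableSet
    (fun _ hA ↦ measurableSet_predictable_singleton_bot_prod (h _ _ hA))
    (fun _ _ hA ↦ measurableSet_predictable_Ioi_prod (h _ _ hA))

/-- Predictable processes are progressively measurable: restrict to `[0, t] × Ω` and take the
section at the endpoint `t`. -/
lemma measurable_section_of_predictable {β : Type*} [MeasurableSpace β]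
    {𝓖 : Filtration (Set.Iic T) mΩ} {f : Set.Iic T × Ω → β} (hf : Measurable[𝓖.predictable] f)
    (t : Set.Iic T) : Measurable[𝓖 t] fun ω ↦ f (t, ω) := by
  have h1 := hf.comp (measurable_inclusion_predictable (𝓕 := 𝓖) (i := t))
  have h2 : @Measurable Ω (Set.Iic t × Ω) (𝓖 t) (Subtype.instMeasurableSpace.prod (𝓖 t))
      fun ω ↦ (⟨t, Set.self_mem_Iic⟩, ω) :=
    @Measurable.prodMk _ _ _ _ _ (𝓖 t) _ _ (@measurable_const _ _ _ (𝓖 t) _) (@measurable_id _ (𝓖 t))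
  exact h1.comp h2

lemma measurable_fst_predictable (𝓖 : Filtration (Set.Iic T) mΩ) :
    Measurable[𝓖.predictable] (Prod.fst : Set.Iic T × Ω → Set.Iic T) := by
  refine @measurable_of_Ioi (Set.Iic T) (Set.Iic T × Ω) _ _ _ 𝓖.predictable _ _ _ _ fun a ↦ ?_
  rw [← Set.prod_univ]
  exact measurableSet_predictable_Ioi_prod (@MeasurableSet.univ _ (𝓖 a))

/-- The point `min (m / (n + 1)) T` of `[0, T]`. -/
noncomputable def gridPoint (T : ℝ≥0) (n m : ℕ) : Set.Iic T := 
  ⟨min ((m : ℝ≥0) / (n + 1)) T, Set.mem_Iic.2 (min_le_right _ _)⟩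

/-- The largest number of a grid point that is strictly before `t`. -/
noncomputable def gridLeft (n : ℕ) (t : Set.Iic T) : ℕ := ⌈((n : ℝ≥0) + 1) * t⌉₊ - 1

/-- The smallest number of a grid point that is strictly after `t`. -/
noncomputable def gridRight (n : ℕ) (t : Set.Iic T) : ℕ := ⌊((n : ℝ≥0) + 1) * t⌋₊ + 1

lemma gridPoint_zero (n : ℕ) : gridPoint T n 0 = ⊥ := by
  apply Subtype.ext; simp [gridPoint]

/-- Truncated subtraction gives `0 - 1 = 0`, so at time `0` the grid point is `0` itself, in
accordance with the convention for the left limit there. -/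
lemma gridLeft_bot (n : ℕ) : gridLeft n (⊥ : Set.Iic T) = 0 := by
  have : ((⊥ : Set.Iic T) : ℝ≥0) = 0 := rfl
  simp [gridLeft, this]

lemma pos_of_bot_lt {t : Set.Iic T} (ht : ⊥ < t) : 0 < (t : ℝ≥0) := ht

lemma gridPoint_gridLeft_lt (n : ℕ) {t : Set.Iic T} (ht : ⊥ < t) :
    gridPoint T n (gridLeft n t) < t := by
  have ht' := pos_of_bot_lt ht
  have hc : 0 < ⌈((n : ℝ≥0) + 1) * t⌉₊ := Nat.ceil_pos.2 (by positivity)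
  have h : ((gridLeft n t : ℕ) : ℝ≥0) < ((n : ℝ≥0) + 1) * t := by
    refine Nat.lt_ceil.1 ?_
    unfold gridLeft; omega
  change min _ _ < (t : ℝ≥0)
  refine min_lt_of_left_lt ?_
  rwa [div_lt_iff₀' (by positivity)]

lemma le_gridPoint_gridLeft_add (n : ℕ) (t : Set.Iic T) :
    (t : ℝ≥0) ≤ gridPoint T n (gridLeft n t) + 1 / ((n : ℝ≥0) + 1) := by
  have h : ((n : ℝ≥0) + 1) * t ≤ (gridLeft n t : ℕ) + 1 := by
    refine (Nat.le_ceil _).trans ?_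
    unfold gridLeft
    exact_mod_cast (by omega : ⌈((n : ℝ≥0) + 1) * t⌉₊ ≤ ⌈((n : ℝ≥0) + 1) * t⌉₊ - 1 + 1)
  change (t : ℝ≥0) ≤ min _ _ + _
  rw [min_add]
  refine le_min ?_ (le_add_right t.2)
  rw [← add_div, le_div_iff₀' (by positivity)]
  exact h

/-- Not strict, because grid points are capped at `T`. Right-continuity needs no more. -/
lemma le_gridPoint_gridRight (n : ℕ) (t : Set.Iic T) : t ≤ gridPoint T n (gridRight n t) := by
  change (t : ℝ≥0) ≤ min _ _
  refine le_min ?_ t.2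
  rw [le_div_iff₀' (by positivity)]
  have := (Nat.lt_floor_add_one (((n : ℝ≥0) + 1) * t)).le
  simpa [gridRight] using this

lemma gridPoint_gridRight_le (n : ℕ) (t : Set.Iic T) :
    (gridPoint T n (gridRight n t) : ℝ≥0) ≤ t + 1 / ((n : ℝ≥0) + 1) := by
  change min _ _ ≤ _
  refine (min_le_left _ _).trans ?_
  rw [div_le_iff₀ (by positivity), add_mul, div_mul_cancel₀ (1 : ℝ≥0) (by positivity)]
  have := Nat.floor_le (zero_le : 0 ≤ ((n : ℝ≥0) + 1) * t)
  simp only [gridRight, Nat.cast_add, Nat.cast_one]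
  rw [mul_comm (t : ℝ≥0)]
  gcongr

lemma tendsto_gridPoint_gridLeft (t : Set.Iic T) :
    Tendsto (fun n ↦ gridPoint T n (gridLeft n t)) atTop (𝓝 t) := by
  rcases eq_bot_or_bot_lt t with rfl | ht
  · simp [gridLeft_bot, gridPoint_zero]
  · rw [tendsto_subtype_rng]
    have h0 : Tendsto (fun n : ℕ ↦ (t : ℝ≥0) - 1 / ((n : ℝ≥0) + 1)) atTop (𝓝 (t - 0)) :=
      tendsto_const_nhds.sub tendsto_one_div_add_atTop_nhds_zero_nat
    rw [tsub_zero] at h0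
    exact tendsto_of_tendsto_of_tendsto_of_le_of_le h0 tendsto_const_nhds
      (fun n ↦ tsub_le_iff_right.2 (le_gridPoint_gridLeft_add n t))
      (fun n ↦ (gridPoint_gridLeft_lt n ht).le)

lemma tendsto_gridPoint_gridRight (t : Set.Iic T) :
    Tendsto (fun n ↦ gridPoint T n (gridRight n t)) atTop (𝓝 t) := by
  rw [tendsto_subtype_rng]
  have h0 : Tendsto (fun n : ℕ ↦ (t : ℝ≥0) + 1 / ((n : ℝ≥0) + 1)) atTop (𝓝 (t + 0)) :=
    tendsto_const_nhds.add tendsto_one_div_add_atTop_nhds_zero_nat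
  rw [add_zero] at h0
  exact tendsto_of_tendsto_of_tendsto_of_le_of_le tendsto_const_nhds h0
    (fun n ↦ le_gridPoint_gridRight n t) (fun n ↦ gridPoint_gridRight_le n t)

variable {E : Type*} [TopologicalSpace E] [TopologicalSpace.PseudoMetrizableSpace E]
  [MeasurableSpace E] [BorelSpace E]

/-- A càdlàg process is jointly measurable. -/
lemma measurable_uncurry_of_cadlag {X : Set.Iic T → Ω → E} (hX : ∀ t, Measurable (X t))
    (hc : ∀ ω, IsCadlag fun t ↦ X t ω) : Measurable fun q : Set.Iic T × Ω ↦ X q.1 q.2 := by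
  refine measurable_of_tendsto_metrizable
    (f := fun n q ↦ X (gridPoint T n (gridRight n q.1)) q.2) (fun n ↦ ?_) ?_
  · have h1 : Measurable fun p : ℕ × Ω ↦ X (gridPoint T n p.1) p.2 :=
      measurable_from_prod_countable_right fun m ↦ hX (gridPoint T n m)
    have h2 : Measurable fun q : Set.Iic T × Ω ↦ (gridRight n q.1, q.2) := by
      unfold gridRight
      fun_prop
    exact Measurable.comp (g := fun p : ℕ × Ω ↦ X (gridPoint T n p.1) p.2)
      (f := fun q : Set.Iic T × Ω ↦ (gridRight n q.1, q.2)) h1 h2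
  · rw [tendsto_pi_nhds]
    intro q
    refine ((hc q.2 q.1).1.tendsto).comp (tendsto_nhdsWithin_iff.2
      ⟨tendsto_gridPoint_gridRight q.1, .of_forall fun n ↦ le_gridPoint_gridRight n q.1⟩)

/-- The left limit process of an adapted càdlàg process is predictable. -/
lemma measurable_leftLim_predictable {𝓖 : Filtration (Set.Iic T) mΩ} {X : Set.Iic T → Ω → E}
    [T2Space E] (hX : ∀ t, Measurable[𝓖 t] (X t)) (hc : ∀ ω, IsCadlag fun t ↦ X t ω) :
    Measurable[𝓖.predictable]
      fun q : Set.Iic T × Ω ↦ Function.leftLim (fun t ↦ X t q.2) q.1 := by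
  refine @measurable_of_tendsto_metrizable _ _ 𝓖.predictable _ _ _ _
    (fun n q ↦ X (gridPoint T n (gridLeft n q.1)) q.2) _ (fun n ↦ ?_) ?_
  · intro B hB
    have hg : Measurable (gridLeft (T := T) n) := by unfold gridLeft; fun_prop
    -- Decompose by grid cell. On cell `m` the time lies strictly after grid point `m`, so the value
    -- at that point is already known and intersecting with the predictable rectangle loses nothing.
    have key : (fun q : Set.Iic T × Ω ↦ X (gridPoint T n (gridLeft n q.1)) q.2) ⁻¹' B =
        ({⊥} ×ˢ (X ⊥ ⁻¹' B)) ∪ ⋃ m : ℕ, (Prod.fst ⁻¹' {t : Set.Iic T | gridLeft n t = m}) ∩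
          (Set.Ioi (gridPoint T n m) ×ˢ (X (gridPoint T n m) ⁻¹' B)) := by
      ext ⟨t, ω⟩
      simp only [Set.mem_preimage, Set.mem_union, Set.mem_prod, Set.mem_singleton_iff,
        Set.mem_iUnion, Set.mem_inter_iff, Set.mem_ofPred_eq, Set.mem_Ioi]
      constructor
      · intro h
        rcases eq_bot_or_bot_lt t with rfl | ht
        · rw [gridLeft_bot, gridPoint_zero] at h
          exact Or.inl ⟨rfl, h⟩
        · exact Or.inr ⟨_, rfl, gridPoint_gridLeft_lt n ht, h⟩
      · rintro (⟨rfl, h⟩ | ⟨m, rfl, -, h⟩)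
        · rwa [gridLeft_bot, gridPoint_zero]
        · exact h
    rw [key]
    refine MeasurableSet.union ?_ (.iUnion fun m ↦ .inter ?_ ?_)
    · exact measurableSet_predictable_singleton_bot_prod (hX _ hB)
    · exact measurable_fst_predictable 𝓖 (hg (measurableSet_singleton m))
    · exact measurableSet_predictable_Ioi_prod (hX _ hB)
  · rw [tendsto_pi_nhds]
    rintro ⟨t, ω⟩
    rcases eq_bot_or_bot_lt t with rfl | ht
    · simp [gridLeft_bot, gridPoint_zero, leftLim_bot]
    · exact ((hc ω).tendsto_leftLim t).comp (tendsto_nhdsWithin_iff.2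
        ⟨tendsto_gridPoint_gridLeft t, .of_forall fun n ↦ gridPoint_gridLeft_lt n ht⟩)

end Measurability

/-! ### Counting paths and their jump times -/

section Counting

variable {T : ℝ≥0}

lemma tsum_subtype_eq_tsum_indicator {ι : Type*} (p : ι → Prop) (g : ι → ℝ≥0∞) :
    ∑' t : {t // p t}, g t = ∑' t, {t | p t}.indicator g t :=
  tsum_subtype {t | p t} g

lemma lintegral_countingMeasure (x : Set.Iic T → ℕ) (f : Set.Iic T → ℝ≥0∞) :
    ∫⁻ t, f t ∂(countingMeasure x) = ∑' t : {t // JumpsAt x t}, f t := by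
  simp [countingMeasure, lintegral_sum_measure]

lemma lintegral_jumpMeasure (x : Set.Iic T → ℝ) (f : Set.Iic T × ℝ → ℝ≥0∞) :
    ∫⁻ q, f q ∂(jumpMeasure x) =
      ∑' t : {t // JumpsAt x t}, f ((t : Set.Iic T), x t - Function.leftLim x t) := by
  simp [jumpMeasure, lintegral_sum_measure]

namespace IsCountingPath

variable {x : Set.Iic T → ℕ}

lemma eq_leftLim_add_one (hx : IsCountingPath x) {t : Set.Iic T} (ht : JumpsAt x t) :
    x t = Function.leftLim x t + 1 := by
  have h1 := hx.jump_le_one t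
  have h2 := hx.mono.leftLim_le (le_refl t)
  unfold JumpsAt at ht
  omega

lemma lt_of_jumpsAt (hx : IsCountingPath x) {s t : Set.Iic T} (hst : s < t) (ht : JumpsAt x t) :
    x s < x t := by
  have h1 := hx.mono.le_leftLim hst
  have h2 := hx.eq_leftLim_add_one ht
  omega

lemma eq_of_jumpsAt (hx : IsCountingPath x) {s t : Set.Iic T} (hs : JumpsAt x s)
    (ht : JumpsAt x t) (h : x s = x t) : s = t := by
  rcases lt_trichotomy s t with hst | hst | hst
  · exact absurd h (hx.lt_of_jumpsAt hst ht).ne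
  · exact hst
  · exact absurd h (hx.lt_of_jumpsAt hst hs).ne'

/-- A value below `n` persists to the left by monotonicity and to the right by right-continuity. -/
lemma isClosed_setOf_le (hx : IsCountingPath x) (n : ℕ) : IsClosed {t | n ≤ x t} := by
  rw [← isOpen_compl_iff, isOpen_iff_mem_nhds]
  intro t ht
  simp only [Set.mem_compl_iff, Set.mem_ofPred_eq, not_le] at ht
  rw [← nhdsLE_sup_nhdsGE, mem_sup]
  constructor
  · filter_upwards [self_mem_nhdsWithin] with s hs
    simpa using (hx.mono hs).trans_lt ht
  · have := (hx.cadlag t).1.tendsto.eventually (gt_mem_nhds ht)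
    filter_upwards [this] with s hs
    simpa using hs

/-- The first time at which the path reaches `n` exists by compactness. The left limit there is
below `n`, and a jump of size at most one must land exactly on `n`. -/
lemma exists_jumpsAt (hx : IsCountingPath x) {n : ℕ} (hn : 1 ≤ n) {t : Set.Iic T}
    (h : n ≤ x t) : ∃ s ≤ t, JumpsAt x s ∧ x s = n := by
  have : CompactSpace (Set.Iic T) := isCompact_iff_compactSpace.1 (by
    rw [← Set.Icc_bot]; exact isCompact_Icc)
  obtain ⟨s, hs, hmin⟩ := (hx.isClosed_setOf_le n).isCompact.exists_isLeast ⟨t, h⟩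
  have hs' : n ≤ x s := hs
  have hbot : ⊥ < s := by
    rw [bot_lt_iff_ne_bot]
    rintro rfl
    rw [hx.zero] at hs'
    omega
  have hlt : Function.leftLim x s < n := by
    have := nhdsLT_neBot hbot
    have h1 := hx.cadlag.tendsto_leftLim s
    rw [nhds_discrete, tendsto_pure] at h1
    obtain ⟨u, hu, hus⟩ := (h1.and self_mem_nhdsWithin).exists
    rw [← hu]
    by_contra! hle
    exact absurd (hmin hle) (not_le.2 hus)
  have hj : JumpsAt x s := by unfold JumpsAt; omega
  refine ⟨s, hmin h, hj, ?_⟩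
  have := hx.jump_le_one s
  omega

end IsCountingPath

open Classical in
/-- The time at which the path `x` jumps to `n`, and `T` if there is none. -/
noncomputable def jumpTime (x : Set.Iic T → ℕ) (n : ℕ) : Set.Iic T :=
  if h : ∃ t, JumpsAt x t ∧ x t = n then h.choose else ⊤

lemma IsCountingPath.jumpTime_eq {x : Set.Iic T → ℕ} (hx : IsCountingPath x) {t : Set.Iic T}
    (ht : JumpsAt x t) : jumpTime x (x t) = t := by
  have h : ∃ s, JumpsAt x s ∧ x s = x t := ⟨t, ht, rfl⟩
  rw [jumpTime, dif_pos h]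
  exact hx.eq_of_jumpsAt h.choose_spec.1 ht h.choose_spec.2

/-- The endpoint is excluded because `T` is also the default value of `jumpTime` for a level never
reached. -/
lemma IsCountingPath.jumpTime_le_iff {x : Set.Iic T → ℕ} (hx : IsCountingPath x) {n : ℕ}
    (hn : 1 ≤ n) {t : Set.Iic T} (ht : t < ⊤) : jumpTime x n ≤ t ↔ n ≤ x t := by
  constructor
  · intro h
    rw [jumpTime] at h
    split_ifs at h with he
    · exact he.choose_spec.2.symm.le.trans (hx.mono h)
    · exact absurd h (not_le.2 ht)
  · intro h
    obtain ⟨s, hst, hs, rfl⟩ := hx.exists_jumpsAt hn h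
    rwa [hx.jumpTime_eq hs]

/-- Each jump is determined by the level it reaches, and the levels reached are `1, …, x ⊤`. The sum
over path-dependent times becomes one over a fixed countable index, from which measurability in `ω`
can be read off. -/
lemma IsCountingPath.lintegral_countingMeasure_eq_tsum {x : Set.Iic T → ℕ}
    (hx : IsCountingPath x) (f : Set.Iic T → ℝ≥0∞) :
    ∫⁻ t, f t ∂(countingMeasure x) =
      ∑' n : ℕ, if n + 1 ≤ x ⊤ then f (jumpTime x (n + 1)) else 0 := by
  have h : ∀ n : {n : ℕ | n + 1 ≤ x ⊤}, ∃ t, JumpsAt x t ∧ x t = n + 1 := fun n ↦ by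
    obtain ⟨s, -, hs⟩ := hx.exists_jumpsAt (Nat.le_add_left 1 n) n.2
    exact ⟨s, hs⟩
  have hmem : ∀ t : {t // JumpsAt x t}, x t - 1 + 1 = x t := fun t ↦ by
    have := hx.eq_leftLim_add_one t.2
    omega
  let e : {t // JumpsAt x t} ≃ {n : ℕ | n + 1 ≤ x ⊤} := Equiv.ofBijective
    (fun t ↦ ⟨x t - 1, by
      rw [Set.mem_ofPred_eq, hmem]; exact hx.mono le_top⟩) ⟨fun s t hst ↦ by
        have h1 : x s - 1 = x t - 1 := congrArg Subtype.val hst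
        have h2 := hmem s
        have h3 := hmem t
        exact Subtype.ext (hx.eq_of_jumpsAt s.2 t.2 (by omega)), fun n ↦ by
        obtain ⟨t, ht, htn⟩ := h n
        exact ⟨⟨t, ht⟩, Subtype.ext (by simp [htn])⟩⟩
  have h1 : ∀ t : {t // JumpsAt x t}, f t = f (jumpTime x ((e t : ℕ) + 1)) := fun t ↦ by
    have : (e t : ℕ) + 1 = x t := hmem t
    rw [this, hx.jumpTime_eq t.2]
  rw [lintegral_countingMeasure, tsum_congr h1,
    e.tsum_eq (fun n : {n : ℕ | n + 1 ≤ x ⊤} ↦ f (jumpTime x ((n : ℕ) + 1))),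
    tsum_subtype {n : ℕ | n + 1 ≤ x ⊤} fun n ↦ f (jumpTime x (n + 1))]
  simp only [Set.indicator_apply, Set.mem_ofPred_eq]

/-- If two counting paths have no common jumps, then the jump measure of `c + x - y` is the sum of
the counting measures of `x` and `y`, carried by the heights `1` and `-1`. -/
lemma lintegral_jumpMeasure_sub {x y : Set.Iic T → ℕ} (hx : IsCountingPath x)
    (hy : IsCountingPath y) (hxy : NoCommonJumps x y) (c : ℝ) (f : Set.Iic T × ℝ → ℝ≥0∞) :
    ∫⁻ q, f q ∂(jumpMeasure fun t ↦ c + x t - y t) =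
      ∫⁻ t, f (t, 1) ∂(countingMeasure x) + ∫⁻ t, f (t, -1) ∂(countingMeasure y) := by
  have hleft : ∀ t, Function.leftLim (fun t ↦ c + (x t : ℝ) - y t) t =
      c + Function.leftLim x t - Function.leftLim y t := fun t ↦ by
    have := (hx.cadlag.prodMk hy.cadlag).leftLim_comp
      (continuous_of_discreteTopology (f := fun p : ℕ × ℕ ↦ c + (p.1 : ℝ) - p.2)) t
    rw [hx.cadlag.leftLim_prodMk hy.cadlag] at this
    exact this
  simp only [lintegral_jumpMeasure, lintegral_countingMeasure]
  -- Written as sums of indicators over all times, the three sums can be compared pointwise: at each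
  -- `t`, only `x` jumps, only `y` jumps, or neither does.
  rw [tsum_subtype_eq_tsum_indicator (fun t ↦ JumpsAt (fun t ↦ c + (x t : ℝ) - y t) t)
      fun t ↦ f (t, c + (x t : ℝ) - y t - Function.leftLim (fun t ↦ c + (x t : ℝ) - y t) t),
    tsum_subtype_eq_tsum_indicator (fun t ↦ JumpsAt x t) fun t ↦ f (t, 1),
    tsum_subtype_eq_tsum_indicator (fun t ↦ JumpsAt y t) fun t ↦ f (t, -1), ← ENNReal.tsum_add]
  refine tsum_congr fun t ↦ ?_
  simp only [Set.indicator, Set.mem_ofPred_eq]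
  have hiff : JumpsAt (fun t ↦ c + (x t : ℝ) - y t) t ↔
      c + (x t : ℝ) - y t ≠ c + Function.leftLim x t - Function.leftLim y t := by
    rw [JumpsAt, hleft]
  simp only [hiff, hleft]
  by_cases h1 : JumpsAt x t
  · have h2 : ¬ JumpsAt y t := fun h2 ↦ hxy t ⟨h1, h2⟩
    have e1 : (x t : ℝ) = Function.leftLim x t + 1 := by exact_mod_cast hx.eq_leftLim_add_one h1
    have e2 : y t = Function.leftLim y t := not_not.1 h2
    have e3 : c + (x t : ℝ) - y t - (c + Function.leftLim x t - Function.leftLim y t) = 1 := by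
      rw [e1, ← e2]; ring
    rw [if_pos h1, if_neg h2, e3, if_pos (fun h ↦ by rw [h, sub_self] at e3; simp at e3), add_zero]
  · have e1 : x t = Function.leftLim x t := not_not.1 h1
    by_cases h2 : JumpsAt y t
    · have e2 : (y t : ℝ) = Function.leftLim y t + 1 := by
        exact_mod_cast hy.eq_leftLim_add_one h2
      have e3 : c + (x t : ℝ) - y t - (c + Function.leftLim x t - Function.leftLim y t) = -1 := by
        rw [e2, ← e1]; ring
      rw [if_neg h1, if_pos h2, e3, if_pos (fun h ↦ by rw [h, sub_self] at e3; simp at e3),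
        zero_add]
    · have e2 : y t = Function.leftLim y t := not_not.1 h2
      rw [if_neg h1, if_neg h2, ← e1, ← e2, if_neg (by simp), add_zero]

variable {Ω : Type*} [mΩ : MeasurableSpace Ω] {N : Set.Iic T → Ω → ℕ}

lemma measurable_jumpTime (hN : ∀ t, Measurable (N t))
    (hc : ∀ ω, IsCountingPath fun t ↦ N t ω) {n : ℕ} (hn : 1 ≤ n) :
    Measurable fun ω ↦ jumpTime (fun t ↦ N t ω) n := by
  refine measurable_of_Iic fun t ↦ ?_
  rcases (le_top : t ≤ ⊤).eq_or_lt with rfl | ht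
  · simp
  · have : (fun ω ↦ jumpTime (fun t ↦ N t ω) n) ⁻¹' Set.Iic t = N t ⁻¹' Set.Ici n := by
      ext ω
      exact (hc ω).jumpTime_le_iff hn ht
    rw [this]
    exact hN t measurableSet_Ici

lemma measurable_lintegral_countingMeasure (hN : ∀ t, Measurable (N t))
    (hc : ∀ ω, IsCountingPath fun t ↦ N t ω) {C : Set.Iic T × Ω → ℝ≥0∞} (hC : Measurable C) :
    Measurable fun ω ↦ ∫⁻ t, C (t, ω) ∂(countingMeasure fun t ↦ N t ω) := by
  simp only [fun ω ↦ (hc ω).lintegral_countingMeasure_eq_tsum fun t ↦ C (t, ω)]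
  refine Measurable.tsum fun n ↦ Measurable.ite ?_ ?_ measurable_const
  · exact hN ⊤ measurableSet_Ici
  · exact hC.comp ((measurable_jumpTime hN hc (Nat.le_add_left 1 n)).prodMk measurable_id)

end Counting

/-! ### Lebesgue measure on `[0, T]` -/

section Lebesgue

variable {T : ℝ≥0}

lemma measurableEmbedding_coe_Iic :
    MeasurableEmbedding fun t : Set.Iic T ↦ ((t : ℝ≥0) : ℝ) :=
  (NNReal.isClosedEmbedding_coe.measurableEmbedding).comp
    (MeasurableEmbedding.subtype_coe measurableSet_Iic)

instance : IsFiniteMeasure (lebesgue T) := ⟨by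
  rw [lebesgue, measurableEmbedding_coe_Iic.comap_apply]
  refine (measure_mono ?_).trans_lt (measure_Icc_lt_top (μ := volume) (a := (0 : ℝ)) (b := T))
  rintro _ ⟨t, -, rfl⟩
  exact ⟨t.1.2, NNReal.coe_le_coe.2 t.2⟩⟩

instance : NullSingletonClass (lebesgue T) := ⟨fun t ↦ by
  rw [lebesgue, measurableEmbedding_coe_Iic.comap_apply, Set.image_singleton,
    measure_singleton]⟩

lemma IsCadlag.ae_leftLim_eq {x : Set.Iic T → ℝ} (hx : IsCadlag x) :
    ∀ᵐ t ∂(lebesgue T), Function.leftLim x t = x t :=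
  hx.countable_jumps.measure_zero _

/-- A càdlàg process and its left limit process have the same integrals over time. -/
lemma lintegral_mul_leftLim {Ω : Type*} {X : Set.Iic T → Ω → ℝ} (hc : ∀ ω, IsCadlag fun t ↦ X t ω)
    (K : Set.Iic T × Ω → ℝ≥0∞) (ω : Ω) :
    ∫⁻ t, K (t, ω) * ENNReal.ofReal (Function.leftLim (fun t ↦ X t ω) t) ∂(lebesgue T) =
      ∫⁻ t, K (t, ω) * ENNReal.ofReal (X t ω) ∂(lebesgue T) :=
  lintegral_congr_ae ((hc ω).ae_leftLim_eq.mono fun t ht ↦ by simp only [ht])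

end Lebesgue

/-! ### Optional projections -/

section Projection

variable {Ω : Type*} [mΩ : MeasurableSpace Ω] {T : ℝ≥0} {P : Measure Ω}

/-- A function that is a.e. equal to an `m`-measurable one is `m`-measurable if `m` contains all
null sets. -/
lemma measurable_of_ae_eq_of_null {β : Type*} [MeasurableSpace β] {m : MeasurableSpace Ω}
    (hnull : ∀ A, P A = 0 → MeasurableSet[m] A) {f g : Ω → β} (hg : Measurable[m] g)
    (hfg : f =ᵐ[P] g) : Measurable[m] f := by
  intro B hB
  have h0 : P {ω | f ω ≠ g ω} = 0 := hfg
  have key : f ⁻¹' B =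
      (g ⁻¹' B \ {ω | f ω ≠ g ω}) ∪ (f ⁻¹' B ∩ {ω | f ω ≠ g ω}) := by
    ext ω
    by_cases h : f ω = g ω <;> simp [h]
  rw [key]
  exact ((hg hB).diff (hnull _ h0)).union (hnull _ (measure_mono_null Set.inter_subset_right h0))

/-- The conditional expectation characterized by nonnegative test functions. -/
lemma lintegral_mul_ofReal_condExp [IsFiniteMeasure P] {m : MeasurableSpace Ω} (hm : m ≤ mΩ)
    {X : Ω → ℝ} (hX : Integrable X P) (hX0 : 0 ≤ᵐ[P] X) {f : Ω → ℝ≥0∞} (hf : Measurable[m] f) :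
    ∫⁻ ω, f ω * ENNReal.ofReal (X ω) ∂P = ∫⁻ ω, f ω * ENNReal.ofReal ((P[X | m]) ω) ∂P := by
  have hZ : Integrable (P[X | m]) P := integrable_condExp
  have hZ0 : 0 ≤ᵐ[P] P[X | m] := condExp_nonneg hX0
  -- The defining property of the conditional expectation says that these two measures agree on `m`;
  -- hence so do the integrals of every `m`-measurable `f ≥ 0`, with no integrability of the product
  -- required.
  have htrim : (P.withDensity fun ω ↦ ENNReal.ofReal (X ω)).trim hm =
      (P.withDensity fun ω ↦ ENNReal.ofReal ((P[X | m]) ω)).trim hm := by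
    refine @Measure.ext _ m _ _ fun A hA ↦ ?_
    rw [trim_measurableSet_eq hm hA, trim_measurableSet_eq hm hA,
      withDensity_apply _ (hm _ hA), withDensity_apply _ (hm _ hA),
      ← ofReal_integral_eq_lintegral_ofReal hX.integrableOn (ae_restrict_of_ae hX0),
      ← ofReal_integral_eq_lintegral_ofReal hZ.integrableOn (ae_restrict_of_ae hZ0),
      setIntegral_condExp hm hX hA]
  have h1 : ∀ Y : Ω → ℝ, Integrable Y P → ∫⁻ ω, f ω * ENNReal.ofReal (Y ω) ∂P =
      ∫⁻ ω, f ω ∂(P.withDensity fun ω ↦ ENNReal.ofReal (Y ω)).trim hm := fun Y hY ↦ by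
    rw [lintegral_trim hm hf, lintegral_withDensity_eq_lintegral_mul₀
      hY.1.aemeasurable.ennreal_ofReal (hf.mono hm le_rfl).aemeasurable]
    simp only [Pi.mul_apply, mul_comm]
  rw [h1 X hX, h1 _ hZ, htrim]

namespace IsOptionalProjection

variable {𝓖 : Filtration (Set.Iic T) mΩ} {X Z : Set.Iic T → Ω → ℝ}

/-- The projection is only prescribed up to null sets at each time, so its adaptedness rests on the
completeness of `𝓖`. -/
lemma measurable (h : IsOptionalProjection P 𝓖 X Z)
    (hnull : ∀ A, P A = 0 → ∀ t, MeasurableSet[𝓖 t] A) (t : Set.Iic T) :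
    Measurable[𝓖 t] (Z t) :=
  measurable_of_ae_eq_of_null (fun A hA ↦ hnull A hA t)
    stronglyMeasurable_condExp.measurable (h.condExp t)

/-- Against `dt` both left limits may be replaced by the values at `t`, so after Tonelli only the
conditional expectation given `𝓖 t` at a fixed `t` is needed, and no projection of `X` at `t-`. -/
lemma lintegral_mul_leftLim_eq [IsFiniteMeasure P] (h : IsOptionalProjection P 𝓖 X Z)
    (hnull : ∀ A, P A = 0 → ∀ t, MeasurableSet[𝓖 t] A) (hc : ∀ ω, IsCadlag fun t ↦ X t ω)
    (hX : ∀ t, Measurable (X t)) (hint : ∀ t, Integrable (X t) P) (hX0 : ∀ t ω, 0 ≤ X t ω)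
    {K : Set.Iic T × Ω → ℝ≥0∞} (hK : Measurable[𝓖.predictable] K) :
    ∫⁻ ω, ∫⁻ t, K (t, ω) * ENNReal.ofReal (Function.leftLim (fun t ↦ X t ω) t)
        ∂(lebesgue T) ∂P =
      ∫⁻ ω, ∫⁻ t, K (t, ω) * ENNReal.ofReal (Function.leftLim (fun t ↦ Z t ω) t)
        ∂(lebesgue T) ∂P := by
  have hZ : ∀ t, Measurable (Z t) := fun t ↦ (h.measurable hnull t).mono (𝓖.le t) le_rfl
  have hK' : Measurable K := hK.mono (predictable_le_prod 𝓖) le_rfl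
  have hXj := measurable_uncurry_of_cadlag hX hc
  have hZj := measurable_uncurry_of_cadlag hZ h.cadlag
  simp only [lintegral_mul_leftLim hc, lintegral_mul_leftLim h.cadlag]
  rw [← lintegral_lintegral_swap (f := fun t ω ↦ K (t, ω) * ENNReal.ofReal (X t ω)),
    ← lintegral_lintegral_swap (f := fun t ω ↦ K (t, ω) * ENNReal.ofReal (Z t ω))]
  · refine lintegral_congr fun t ↦ ?_
    rw [lintegral_mul_ofReal_condExp (𝓖.le t) (hint t) (.of_forall (hX0 t))
      (measurable_section_of_predictable hK t)]
    exact lintegral_congr_ae ((h.condExp t).mono fun ω hω ↦ by simp only [hω])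
  · exact (hK'.mul hZj.ennreal_ofReal).aemeasurable
  · exact (hK'.mul hXj.ennreal_ofReal).aemeasurable

/-- The exceptional null set of the conditional expectation depends on `t`. Countably many grid
times share one null set, and right-continuity extends the bounds to all times. -/
lemma ae_mem_Icc [IsFiniteMeasure P] (h : IsOptionalProjection P 𝓖 X Z)
    (hint : ∀ t, Integrable (X t) P) (hX0 : ∀ t ω, 0 ≤ X t ω) (hX1 : ∀ t ω, X t ω ≤ 1) :
    ∀ᵐ ω ∂P, ∀ t, Z t ω ∈ Set.Icc (0 : ℝ) 1 := by
  have h1 : ∀ t, ∀ᵐ ω ∂P, Z t ω ∈ Set.Icc (0 : ℝ) 1 := fun t ↦ by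
    have h0 : 0 ≤ᵐ[P] P[X t | 𝓖 t] := condExp_nonneg (.of_forall (hX0 t))
    have h1 : P[X t | 𝓖 t] ≤ᵐ[P] P[fun _ ↦ (1 : ℝ) | 𝓖 t] :=
      condExp_mono (hint t) (integrable_const _) (.of_forall (hX1 t))
    rw [condExp_const (𝓖.le t)] at h1
    filter_upwards [h.condExp t, h0, h1] with ω hω h0 h1
    rw [hω]
    exact ⟨h0, h1⟩
  have h2 : ∀ᵐ ω ∂P, ∀ n m : ℕ, Z (gridPoint T n m) ω ∈ Set.Icc (0 : ℝ) 1 :=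
    ae_all_iff.2 fun n ↦ ae_all_iff.2 fun m ↦ h1 _
  filter_upwards [h2] with ω hω t
  exact isClosed_Icc.mem_of_tendsto (((h.cadlag ω t).1.tendsto).comp (tendsto_nhdsWithin_iff.2
    ⟨tendsto_gridPoint_gridRight t, .of_forall fun n ↦ le_gridPoint_gridRight n t⟩))
    (.of_forall fun n ↦ hω n _)

lemma ae_leftLim_mem_Icc [IsFiniteMeasure P] (h : IsOptionalProjection P 𝓖 X Z)
    (hint : ∀ t, Integrable (X t) P) (hX0 : ∀ t ω, 0 ≤ X t ω) (hX1 : ∀ t ω, X t ω ≤ 1) :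
    ∀ᵐ ω ∂P, ∀ t, Function.leftLim (fun t ↦ Z t ω) t ∈ Set.Icc (0 : ℝ) 1 := by
  filter_upwards [h.ae_mem_Icc hint hX0 hX1] with ω hω t
  rcases eq_bot_or_bot_lt t with rfl | ht
  · rw [leftLim_bot]
    exact hω ⊥
  · have := nhdsLT_neBot ht
    exact isClosed_Icc.mem_of_tendsto ((h.cadlag ω).tendsto_leftLim t) (.of_forall hω)

end IsOptionalProjection

end Projection

/-! ### The observable filtration and observable intensities -/

section Model

variable {Ω : Type*} [mΩ : MeasurableSpace Ω] {T : ℝ≥0} {k : ℕ} {par : Parameters T k}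
  {S : Observation T Ω}

namespace Observation

lemma natural_le (S : Observation T Ω) : S.natural ≤ S.𝔽 := by
  intro t
  refine sup_le (iSup₂_le fun u hu ↦ sup_le ?_ (iSup_le fun s ↦ ?_))
    (S.null_le.trans (S.𝔽.mono bot_le))
  · exact ((S.W_adapted u).comap_le).trans (S.𝔽.mono hu)
  · exact ((S.N_adapted s u).comap_le).trans (S.𝔽.mono hu)

/-- Right-continuity of `𝔽` absorbs the look into the immediate future made by `rightCont`. -/
lemma obs_le (S : Observation T Ω) : S.obs ≤ S.𝔽 := by
  intro t
  have h := S.rightContinuous.RC t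
  refine le_trans ?_ h
  rw [obs, Filtration.rightCont_apply, Filtration.rightCont_apply]
  split_ifs
  · exact iInf₂_mono fun u _ ↦ S.natural_le u
  · exact S.natural_le t

lemma measurable_N_obs (S : Observation T Ω) (s : Side) (t : Set.Iic T) :
    Measurable[S.obs t] (S.N s t) := by
  have h : MeasurableSpace.comap (S.N s t) inferInstance ≤ S.natural t :=
    le_sup_of_le_left (le_iSup₂_of_le t le_rfl (le_sup_of_le_right (le_iSup
      (fun s ↦ MeasurableSpace.comap (S.N s t) inferInstance) s)))
  exact measurable_iff_comap_le.2 (h.trans (S.natural.le_rightCont t))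

lemma active_nonneg (n₀ : ℤ) (Nmax : ℕ∞) (s : Side) (q : Set.Iic T × Ω) :
    0 ≤ S.active n₀ Nmax s q := by
  unfold active; split_ifs <;> simp

lemma active_le_one (n₀ : ℤ) (Nmax : ℕ∞) (s : Side) (q : Set.Iic T × Ω) :
    S.active n₀ Nmax s q ≤ 1 := by
  unfold active; split_ifs <;> simp

end Observation

namespace Model

lemma isCadlag_inventory (M : Model par S) (n₀ : ℤ) (ω : Ω) : IsCadlag fun t ↦ S.inventory n₀ t ω :=
  ((M.counting .minus ω).cadlag.prodMk (M.counting .plus ω).cadlag).comp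
    (continuous_of_discreteTopology (f := fun p : ℕ × ℕ ↦ n₀ + (p.1 : ℤ) - p.2))

lemma measurable_active (M : Model par S) (n₀ : ℤ) (Nmax : ℕ∞) (s : Side) :
    Measurable[S.obs.predictable] (S.active n₀ Nmax s) := by
  have h : Measurable[S.obs.predictable] fun q : Set.Iic T × Ω ↦
      Function.leftLim (fun t ↦ S.inventory n₀ t q.2) q.1 := by
    refine measurable_leftLim_predictable (fun t ↦ ?_) (M.isCadlag_inventory n₀)
    have h1 := S.measurable_N_obs .minus t
    have h2 := S.measurable_N_obs .plus t
    exact (Measurable.of_discrete (f := fun p : ℕ × ℕ ↦ n₀ + (p.1 : ℤ) - p.2)).comp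
      (h1.prodMk h2)
  classical
  exact (measurable_from_top (f := fun z : ℤ ↦
    if BelowCap Nmax (s.sign * z) then (1 : ℝ) else 0)).comp h

lemma measurableSet_obs_of_null (M : Model par S)
    (α : S.Strategy (spreadRange par.lo par.hi)) (A : Set Ω)
    (hA : M.P α A = 0) (t : Set.Iic T) : MeasurableSet[S.obs t] A := by
  have h : MeasurableSet[S.null] A := by
    rw [M.null_eq α]
    exact MeasurableSpace.measurableSet_generateFrom hA
  exact S.natural.le_rightCont t A ((le_sup_right : S.null ≤ S.natural t) A h)

lemma measurable_regime (M : Model par S) (i : Fin k) (t : Set.Iic T)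
    (α : S.Strategy (spreadRange par.lo par.hi)) :
    Measurable ((M.Y t ⁻¹' {i}).indicator fun _ ↦ (1 : ℝ)) :=
  measurable_const.indicator
    (((M.markovChain α).adapted t).mono (S.𝔽.le t) le_rfl (measurableSet_singleton i))

end Model

lemma measurable_spread (α : S.Strategy (spreadRange par.lo par.hi)) (s : Side) (i : Fin k) :
    Measurable[S.obs.predictable] fun q ↦ par.Λ s i ((α s).1 q) :=
  (par.Λ_continuous s i).measurable.comp (α s).2.1

/-- `Λ` may be unbounded near `-∞`. A bounded spread, however, takes its values in a compact part of
the closed set `spreadRange par.lo par.hi`, where the continuous `Λ` is bounded. -/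
lemma exists_bound (α : S.Strategy (spreadRange par.lo par.hi)) (s : Side) (i : Fin k) :
    ∃ c, ∀ q, par.Λ s i ((α s).1 q) ≤ c := by
  obtain ⟨c, hc⟩ := (α s).2.2
  have hcl : IsClosed (spreadRange par.lo par.hi) :=
    (isClosed_le continuous_const continuous_coe_real_ereal).inter
      (isClosed_le continuous_coe_real_ereal continuous_const)
  have hcpt : IsCompact ((↑) ⁻¹' Set.Icc (-c) c : Set (spreadRange par.lo par.hi)) :=
    hcl.isClosedEmbedding_subtypeVal.isCompact_preimage isCompact_Icc
  obtain ⟨b, hb⟩ := hcpt.bddAbove_image (par.Λ_continuous s i).continuousOn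
  exact ⟨b, fun q ↦ hb ⟨_, abs_le.1 (hc q), rfl⟩⟩

/-- Sums can be taken out of the integral of nonnegative jointly measurable processes. -/
lemma lintegral_lintegral_sum {ι : Type*} [Fintype ι] {P : Measure Ω}
    {f : ι → Set.Iic T × Ω → ℝ≥0∞} (hf : ∀ i, Measurable (f i)) :
    ∫⁻ ω, ∫⁻ t, ∑ i, f i (t, ω) ∂(lebesgue T) ∂P =
      ∑ i, ∫⁻ ω, ∫⁻ t, f i (t, ω) ∂(lebesgue T) ∂P := by
  rw [← lintegral_finsetSum _ fun i _ ↦ (hf i).lintegral_prod_left']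
  exact lintegral_congr fun ω ↦ lintegral_finsetSum _ fun i _ ↦
    (hf i).comp measurable_prodMk_right

/-! ### The filter and the passage to observable intensities -/

section Filter

variable {M : Model par S} {α : S.Strategy (spreadRange par.lo par.hi)}
  {π : Fin k → Set.Iic T → Ω → ℝ}

lemma Model.isCadlag_regime (M : Model par S) (α : S.Strategy (spreadRange par.lo par.hi))
    (i : Fin k) (ω : Ω) :
    IsCadlag fun t ↦ (M.Y t ⁻¹' {i}).indicator (fun _ ↦ (1 : ℝ)) ω :=
  ((M.markovChain α).cadlag ω).comp
    (continuous_of_discreteTopology (f := ({i} : Set (Fin k)).indicator fun _ ↦ (1 : ℝ)))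

lemma Model.leftLim_regime (M : Model par S) (α : S.Strategy (spreadRange par.lo par.hi))
    (i : Fin k) (ω : Ω) (t : Set.Iic T) :
    Function.leftLim (fun t ↦ (M.Y t ⁻¹' {i}).indicator (fun _ ↦ (1 : ℝ)) ω) t =
      if i = Function.leftLim (fun t ↦ M.Y t ω) t then 1 else 0 := by
  have := ((M.markovChain α).cadlag ω).leftLim_comp
    (continuous_of_discreteTopology (f := ({i} : Set (Fin k)).indicator fun _ ↦ (1 : ℝ))) t
  refine this.trans ?_
  classical
  rw [Set.indicator_apply]
  simp only [Set.mem_singleton_iff, eq_comm]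

lemma Model.integrable_regime (M : Model par S) (α : S.Strategy (spreadRange par.lo par.hi))
    (i : Fin k) (t : Set.Iic T) :
    Integrable ((M.Y t ⁻¹' {i}).indicator fun _ ↦ (1 : ℝ)) (M.P α) :=
  have := M.isProbabilityMeasure α
  (integrable_const 1).indicator
    (((M.markovChain α).adapted t).mono (S.𝔽.le t) le_rfl (measurableSet_singleton i))

namespace Model.IsFilter

lemma ae_leftLim_mem_Icc (hπ : M.IsFilter α π) :
    ∀ᵐ ω ∂(M.P α), ∀ i t, Function.leftLim (fun t ↦ π i t ω) t ∈ Set.Icc (0 : ℝ) 1 := by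
  have := M.isProbabilityMeasure α
  exact ae_all_iff.2 fun i ↦ (hπ i).ae_leftLim_mem_Icc (M.integrable_regime α i)
    (fun t ω ↦ Set.indicator_nonneg (fun _ _ ↦ zero_le_one) ω)
    (fun t ω ↦ Set.indicator_le_self' (fun _ _ ↦ zero_le_one) ω)

lemma measurable_leftLim (hπ : M.IsFilter α π) (i : Fin k) :
    Measurable[S.obs.predictable] fun q ↦ Function.leftLim (fun t ↦ π i t q.2) q.1 :=
  measurable_leftLim_predictable ((hπ i).measurable (M.measurableSet_obs_of_null α)) (hπ i).cadlag

lemma measurable_observableIntensity (hπ : M.IsFilter α π) (s : Side) :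
    Measurable[S.obs.predictable] (observableIntensity par S π α s) :=
  (M.measurable_active _ _ s).mul (Finset.measurable_fun_sum _ fun i _ ↦
    (hπ.measurable_leftLim i).mul (measurable_spread α s i))

lemma ae_observableIntensity_nonneg (hπ : M.IsFilter α π) (s : Side) :
    ∀ᵐ ω ∂(M.P α), ∀ t, 0 ≤ observableIntensity par S π α s (t, ω) := by
  filter_upwards [hπ.ae_leftLim_mem_Icc] with ω hω t
  exact mul_nonneg (S.active_nonneg _ _ s _) (Finset.sum_nonneg fun i _ ↦
    mul_nonneg (hω i t).1 (par.Λ_pos s i _).le)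

lemma ae_lintegral_observableIntensity_lt_top (hπ : M.IsFilter α π) (s : Side) :
    ∀ᵐ ω ∂(M.P α),
      ∫⁻ t, ENNReal.ofReal (observableIntensity par S π α s (t, ω)) ∂(lebesgue T) < ∞ := by
  choose c hc using exists_bound α s
  filter_upwards [hπ.ae_leftLim_mem_Icc] with ω hω
  have hb : ∀ t, observableIntensity par S π α s (t, ω) ≤ ∑ i, c i := fun t ↦ by
    refine (mul_le_of_le_one_left (Finset.sum_nonneg fun i _ ↦
      mul_nonneg (hω i t).1 (par.Λ_pos s i _).le) (S.active_le_one _ _ s _)).trans ?_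
    exact Finset.sum_le_sum fun i _ ↦
      (mul_le_of_le_one_left (par.Λ_pos s i _).le (hω i t).2).trans (hc i _)
  calc ∫⁻ t, ENNReal.ofReal (observableIntensity par S π α s (t, ω)) ∂(lebesgue T)
      ≤ ∫⁻ _, ENNReal.ofReal (∑ i, c i) ∂(lebesgue T) :=
        lintegral_mono fun t ↦ ENNReal.ofReal_le_ofReal (hb t)
    _ < ∞ := by
        rw [lintegral_const]
        exact ENNReal.mul_lt_top ENNReal.ofReal_lt_top (measure_lt_top _ _)

lemma lintegral_fullIntensity_eq (hπ : M.IsFilter α π) (s : Side) {C : Set.Iic T × Ω → ℝ≥0∞}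
    (hC : Measurable[S.obs.predictable] C) :
    ∫⁻ ω, ∫⁻ t, C (t, ω) * ENNReal.ofReal (fullIntensity par S M.Y α s (t, ω))
        ∂(lebesgue T) ∂(M.P α) =
      ∫⁻ ω, ∫⁻ t, C (t, ω) * ENNReal.ofReal (observableIntensity par S π α s (t, ω))
        ∂(lebesgue T) ∂(M.P α) := by
  have := M.isProbabilityMeasure α
  -- The observable factor in regime `i`: everything in the integrand except the regime indicator or
  -- its filter weight.
  let K : Fin k → Set.Iic T × Ω → ℝ≥0∞ := fun i q ↦
    C q * ENNReal.ofReal (S.active par.n₀ par.Nmax s q * par.Λ s i ((α s).1 q))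
  have hK : ∀ i, Measurable[S.obs.predictable] (K i) := fun i ↦
    hC.mul ((M.measurable_active _ _ s).mul (measurable_spread α s i)).ennreal_ofReal
  have hK' : ∀ i, Measurable (K i) := fun i ↦ (hK i).mono (predictable_le_prod _) le_rfl
  let R : Fin k → Set.Iic T × Ω → ℝ := fun i q ↦
    Function.leftLim (fun t ↦ (M.Y t ⁻¹' {i}).indicator (fun _ ↦ (1 : ℝ)) q.2) q.1
  have hR : ∀ i, Measurable (R i) := fun i ↦
    (measurable_leftLim_predictable (𝓖 := S.𝔽) (fun t ↦ measurable_const.indicator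
      ((M.markovChain α).adapted t (measurableSet_singleton i)))
      (M.isCadlag_regime α i)).mono (predictable_le_prod _) le_rfl
  let L : Fin k → Set.Iic T × Ω → ℝ := fun i q ↦ Function.leftLim (fun t ↦ π i t q.2) q.1
  have hL : ∀ i, Measurable (L i) := fun i ↦
    (hπ.measurable_leftLim i).mono (predictable_le_prod _) le_rfl
  have h1 : ∀ q, C q * ENNReal.ofReal (fullIntensity par S M.Y α s q) =
      ∑ i, K i q * ENNReal.ofReal (R i q) := fun q ↦ by
    simp only [R, M.leftLim_regime α, K, fullIntensity]
    rw [Finset.sum_eq_single (Function.leftLim (fun t ↦ M.Y t q.2) q.1)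
      (fun i _ hi ↦ by simp [hi]) (fun h ↦ absurd (Finset.mem_univ _) h)]
    simp
  -- Only almost sure, unlike `h1`: `ENNReal.ofReal` is additive on nonnegative terms, and the
  -- filter weights are nonnegative only off a null set.
  have h2 : ∀ᵐ ω ∂(M.P α), ∀ t,
      C (t, ω) * ENNReal.ofReal (observableIntensity par S π α s (t, ω)) =
        ∑ i, K i (t, ω) * ENNReal.ofReal (L i (t, ω)) := by
    filter_upwards [hπ.ae_leftLim_mem_Icc] with ω hω t
    have hact := S.active_nonneg par.n₀ par.Nmax s (t, ω)
    rw [observableIntensity, Finset.mul_sum, ENNReal.ofReal_sum_of_nonneg fun i _ ↦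
      mul_nonneg hact (mul_nonneg (hω i t).1 (par.Λ_pos s i _).le), Finset.mul_sum]
    refine Finset.sum_congr rfl fun i _ ↦ ?_
    simp only [K, L]
    rw [mul_assoc, ← ENNReal.ofReal_mul (mul_nonneg hact (par.Λ_pos s i _).le)]
    congr 2
    ring
  have h3 : ∫⁻ ω, ∫⁻ t, C (t, ω) * ENNReal.ofReal (observableIntensity par S π α s (t, ω))
        ∂(lebesgue T) ∂(M.P α) =
      ∫⁻ ω, ∫⁻ t, ∑ i, K i (t, ω) * ENNReal.ofReal (L i (t, ω)) ∂(lebesgue T) ∂(M.P α) :=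
    lintegral_congr_ae (h2.mono fun ω hω ↦ lintegral_congr hω)
  rw [h3]
  simp only [h1]
  rw [lintegral_lintegral_sum (f := fun i q ↦ K i q * ENNReal.ofReal (R i q))
      fun i ↦ (hK' i).mul (hR i).ennreal_ofReal,
    lintegral_lintegral_sum (f := fun i q ↦ K i q * ENNReal.ofReal (L i q))
      fun i ↦ (hK' i).mul (hL i).ennreal_ofReal]
  exact Finset.sum_congr rfl fun i _ ↦ (hπ i).lintegral_mul_leftLim_eq
    (M.measurableSet_obs_of_null α) (M.isCadlag_regime α i)
    (fun t ↦ M.measurable_regime i t α) (M.integrable_regime α i)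
    (fun t ω ↦ Set.indicator_nonneg (fun _ _ ↦ zero_le_one) ω) (hK i)

theorem hasPredictableIntensity (hπ : M.IsFilter α π) (s : Side) :
    HasPredictableIntensity (M.P α) S.obs (S.N s) (observableIntensity par S π α s) where
  predictable := hπ.measurable_observableIntensity s
  nonneg := hπ.ae_observableIntensity_nonneg s
  integrable := hπ.ae_lintegral_observableIntensity_lt_top s
  projection C hC := ((M.intensity α s).projection C
    (hC.mono (predictable_mono S.obs_le) le_rfl)).trans (hπ.lintegral_fullIntensity_eq s hC)

theorem hasPredictableIntensityKernel (hπ : M.IsFilter α π) :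
    HasPredictableIntensityKernel (M.P α) S.obs (fun t ω ↦ (S.inventory par.n₀ t ω : ℝ))
      (observableKernel par S π α) where
  predictable := by
    refine @Measure.measurable_of_measurable_coe _ _ _ S.obs.predictable _ fun B hB ↦ ?_
    simp only [observableKernel, Measure.coe_add, Pi.add_apply, Measure.smul_apply, smul_eq_mul]
    exact ((hπ.measurable_observableIntensity .minus).ennreal_ofReal.mul_const _).add
      ((hπ.measurable_observableIntensity .plus).ennreal_ofReal.mul_const _)
  integrable := by
    filter_upwards [hπ.ae_lintegral_observableIntensity_lt_top .minus,
      hπ.ae_lintegral_observableIntensity_lt_top .plus] with ω h1 h2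
    have hm : Measurable fun t ↦
        ENNReal.ofReal (observableIntensity par S π α .minus (t, ω)) :=
      ((hπ.measurable_observableIntensity .minus).mono (predictable_le_prod _)
        le_rfl).ennreal_ofReal.comp measurable_prodMk_right
    simp only [observableKernel, Measure.coe_add, Pi.add_apply, Measure.smul_apply, smul_eq_mul,
      measure_univ, mul_one]
    rw [lintegral_add_left hm]
    exact ENNReal.add_lt_top.2 ⟨h1, h2⟩
  projection H hH := by
    have := M.isProbabilityMeasure α
    have hsec : ∀ z : ℝ, Measurable[S.obs.predictable] fun q : Set.Iic T × Ω ↦ H (q, z) :=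
      fun z ↦ hH.comp (@measurable_prodMk_right _ _ S.obs.predictable (borel ℝ) z)
    have hN : ∀ s t, Measurable (S.N s t) := fun s t ↦
      (S.N_adapted s t).mono (S.𝔽.le t) le_rfl
    have hleft : ∀ᵐ ω ∂(M.P α),
        ∫⁻ q, H ((q.1, ω), q.2) ∂(jumpMeasure fun t ↦ (S.inventory par.n₀ t ω : ℝ)) =
          ∫⁻ t, H ((t, ω), 1) ∂(countingMeasure fun t ↦ S.N .minus t ω) +
            ∫⁻ t, H ((t, ω), -1) ∂(countingMeasure fun t ↦ S.N .plus t ω) := by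
      filter_upwards [M.noCommonJumps α] with ω hω
      rw [← lintegral_jumpMeasure_sub (M.counting .minus ω) (M.counting .plus ω) hω par.n₀
        fun q ↦ H ((q.1, ω), q.2)]
      simp only [Observation.inventory, Int.cast_sub, Int.cast_add, Int.cast_natCast]
    have hright : ∀ q : Set.Iic T × Ω, ∫⁻ z, H (q, z) ∂(observableKernel par S π α q) =
        H (q, 1) * ENNReal.ofReal (observableIntensity par S π α .minus q) +
          H (q, -1) * ENNReal.ofReal (observableIntensity par S π α .plus q) := fun q ↦ by
      simp only [observableKernel, lintegral_add_measure, lintegral_smul_measure, lintegral_dirac,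
        smul_eq_mul, mul_comm]
    have hm : Measurable fun q : Set.Iic T × Ω ↦
        H (q, 1) * ENNReal.ofReal (observableIntensity par S π α .minus q) :=
      ((hsec 1).mul (hπ.measurable_observableIntensity .minus).ennreal_ofReal).mono
        (predictable_le_prod _) le_rfl
    have hadd : ∀ ω, ∫⁻ t, (H ((t, ω), 1) *
          ENNReal.ofReal (observableIntensity par S π α .minus (t, ω)) +
        H ((t, ω), -1) * ENNReal.ofReal (observableIntensity par S π α .plus (t, ω)))
          ∂(lebesgue T) =
        ∫⁻ t, H ((t, ω), 1) * ENNReal.ofReal (observableIntensity par S π α .minus (t, ω))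
          ∂(lebesgue T) +
        ∫⁻ t, H ((t, ω), -1) * ENNReal.ofReal (observableIntensity par S π α .plus (t, ω))
          ∂(lebesgue T) := fun ω ↦
      lintegral_add_left (hm.comp measurable_prodMk_right) _
    simp only [hright, hadd]
    -- Splitting the expectation of a sum requires one summand to be measurable in `ω`; for the
    -- counting integral this comes from the enumeration of the jumps by level.
    rw [lintegral_congr_ae hleft, lintegral_add_left (measurable_lintegral_countingMeasure
        (hN .minus) (M.counting .minus) ((hsec 1).mono (predictable_le_prod _) le_rfl)),
      lintegral_add_left hm.lintegral_prod_left',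
      (hπ.hasPredictableIntensity .minus).projection _ (hsec 1),
      (hπ.hasPredictableIntensity .plus).projection _ (hsec (-1))]

end Model.IsFilter

end Filter

end Model

end MarketMaking

theorem mainTheorem8 {Ω : Type*} [MeasurableSpace Ω] {T : ℝ≥0} (hT : 0 < T) {k : ℕ}
    (par : MarketMaking.Parameters T k) (S : MarketMaking.Observation T Ω)
    (M : MarketMaking.Model par S)
    (α : S.Strategy (MarketMaking.spreadRange par.lo par.hi))
    (π : Fin k → Set.Iic T → Ω → ℝ) (hπ : M.IsFilter α π) :
    (∀ s : MarketMaking.Side,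
      MarketMaking.HasPredictableIntensity (M.P α) S.obs (S.N s)
        (MarketMaking.observableIntensity par S π α s)) ∧
    MarketMaking.HasPredictableIntensityKernel (M.P α) S.obs
      (fun t ω ↦ (S.inventory par.n₀ t ω : ℝ))
      (MarketMaking.observableKernel par S π α) :=
  ⟨hπ.hasPredictableIntensity, hπ.hasPredictableIntensityKernel⟩
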